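/- Let $k$ be a field. A matrix $\mathbf p=(p_{ij})\in M_n(k^\times)$ is called multiplicatively antisymmetric if $p_{ii}=1$ and $p_{ij}=p_{ji}^{-1}$ for all $i,j$. For $\lambda\in k^\times$ and a multiplicatively antisymmetric $\mathbf p\in M_n(k^\times)$, the multiparameter quantum matrix algebra $\mathcal O_{\lambda,\mathbf p}(\mathcal M_n(k))$ is the $k$-algebra generated by $X_{ij}$, $1\le i,j\le n$, subject to the relations \[ X_{lm}X_{ij}=\begin{cases} p_{li}p_{jm}X_{ij}X_{lm}+(\lambda-1)p_{li}X_{im}X_{lj} & l>i,\ m>j,\\ \lambda p_{li}p_{jm}X_{ij}X_{lm} & l>i,\ m\le j,\\ p_{jm}X_{ij}X_{lm} & l=i,\ m>j. \end{cases} \] Let $n,m$ be non-negative integers, at least one of which is $\ge 2$, let $\lambda,\mu\in k^\times$ with $\lambda\ne\pm1$, and let $\mathbf p\in M_n(k^\times)$ and $\mathbf q\in M_m(k^\times)$ be multiplicatively antisymmetric. Then $\mathcal O_{\lambda,\mathbf p}(\mathcal M_n(k))$ and $\mathcal O_{\mu,\mathbf q}(\mathcal M_m(k))$ are isomorphic as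 $k$-algebras if and only if $n=m$ and one of the following holds: (1) $\lambda=\mu$ and $p_{ij}=q_{ij}$ for all $i,j$; (2) $\lambda=\mu$ and $p_{ij}=\lambda^{-1}q_{ji}$ for all $i>j$; (3) $\lambda=\mu^{-1}$ and $p_{ij}=q_{n+1-i,\,n+1-j}$ for all $i,j$; (4) $\lambda=\mu^{-1}$ and $p_{ij}=\lambda^{-1}q_{n+1-j,\,n+1-i}$ for all $i>j$. -/

import Mathlib

/-- A matrix `p` with entries in `kˣ` is multiplicatively antisymmetric if `p i i = 1` and
`p i j = (p j i)⁻¹` for all `i`, `j`. -/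
def IsMultiplicativelyAntisymmetric {k : Type*} [Field k] {n : ℕ}
    (p : Matrix (Fin n) (Fin n) kˣ) : Prop :=
  (∀ i, p i i = 1) ∧ ∀ i j, i ≠ j → p i j = (p j i)⁻¹

namespace QuantumMatrixAlgebra

/-- The free generator `X_{ij}`. -/
def freeX (k : Type*) [Field k] {n : ℕ} (i j : Fin n) : FreeAlgebra k (Fin n × Fin n) :=
  FreeAlgebra.ι k (i, j)

/-- The defining relations of the multiparameter quantum matrix algebra: the left-hand side is
`X_{lm} X_{ij}`, in the three cases `l > i, m > j`; `l > i, m ≤ j`; and `l = i, m > j`. -/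
inductive Rel {k : Type*} [Field k] {n : ℕ} (lam : kˣ) (p : Matrix (Fin n) (Fin n) kˣ) :
    FreeAlgebra k (Fin n × Fin n) → FreeAlgebra k (Fin n × Fin n) → Prop
  | cross (l m i j : Fin n) (hl : i < l) (hm : j < m) :
      Rel lam p (freeX k l m * freeX k i j)
        (((p l i : k) * (p j m : k)) • (freeX k i j * freeX k l m)
          + (((lam : k) - 1) * (p l i : k)) • (freeX k i m * freeX k l j))
  | anti (l m i j : Fin n) (hl : i < l) (hm : m ≤ j) :
      Rel lam p (freeX k l m * freeX k i j)
        (((lam : k) * (p l i : k) * (p j m : k)) • (freeX k i j * freeX k l m))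
  | row (i m j : Fin n) (hm : j < m) :
      Rel lam p (freeX k i m * freeX k i j)
        ((p j m : k) • (freeX k i j * freeX k i m))

end QuantumMatrixAlgebra

/-- The multiparameter quantum `n × n` matrix algebra `O_{λ,p}(M_n(k))`: the quotient of the free
`k`-algebra on `X_{ij}`, `1 ≤ i, j ≤ n`, by the defining relations. -/
abbrev QuantumMatrixAlgebra {k : Type*} [Field k] {n : ℕ} (lam : kˣ)
    (p : Matrix (Fin n) (Fin n) kˣ) : Type _ :=
  RingQuot (QuantumMatrixAlgebra.Rel lam p)

/-!
An isomorphism between two quantum matrix algebras, graded or not, is controlled by the quadratic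
relations alone. Write `I = Fin n × Fin n`, `V` for the span of the generators `X_{ij}`, and
`R ⊆ V ⊗ V` for the space of relations. The annihilator of `R`, seen as a space of `I × I` matrices,
is `quadraticDual lam p`.

*Reduction to linear algebra.* Let `φ : A → B` be an algebra isomorphism. Expand each `φ X_a` into
constant, linear and quadratic terms, and let `L` be the matrix of linear terms (`jacobian`). Every
`χ`-derivation of `A`, where `χ` is the character `x ↦ (constant term of φ x)`, is determined by its
values on the generators, so the rows of `L` are linearly independent; applied to `φ` and `φ⁻¹` this
gives `n = m` and the invertibility of `L`. The constant terms need not vanish, but because `L` is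
invertible they only contribute elements of the quadratic dual of `A`, so `β ↦ Lᵀ β L` maps the
quadratic dual of `B` into that of `A` (`jacobian_map`), bijectively by a dimension count
(`exists_congruence`).

*Rigidity.* A degree-preserving derivation of `A`, given by a matrix `D` with
`Dᵀ γ + γ D ∈ quadraticDual lam p` for all `γ ∈ quadraticDual lam p`, is diagonal as soon as
`lam ≠ 1` and `2 ≤ n` (`eq_zero_of_ne`); this only involves the relations inside `2 × 2` submatrices.
The diagonal matrices with entries `r i + s j` are derivations of `B`, and they separate the
positions `(i, j)`. Conjugating them by `L` gives derivations of `A`, which are diagonal, and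
therefore `L` is monomial: it has the form `X_a ↦ c_a Y_{w a}` (`exists_monomial`).

*Combinatorics.* The relation between the two diagonals of a `2 × 2` submatrix has a third term since
`lam ≠ 1`. This forces `w` to map such submatrices to such submatrices, diagonals to diagonals and
antidiagonals to antidiagonals (`preservesRectangles_of_monomial`). The only such permutations of the
grid are the identity, the transpose, the half turn and the reflection in the antidiagonal
(`PreservesRectangles.classification`). Comparing the commutation constants along rows and columns
gives the four families of parameters (`parameters_of_monomial`). Conversely, the transpose and the
half turn do define isomorphisms (`transposeEquiv`, `revEquiv`).
-/

namespace QuantumMatrixAlgebra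

/-! ### The annihilator of the quadratic relations -/

/-- The bilinear forms on the span of the generators that kill the defining relations, where the
form `β` is stored as its matrix of values `β a b` on `X_a ⊗ X_b`. -/
def quadraticDual {k : Type*} [Field k] {n : ℕ} (lam : kˣ) (p : Matrix (Fin n) (Fin n) kˣ) :
    Submodule k (Matrix (Fin n × Fin n) (Fin n × Fin n) k) where
  carrier := {β |
    (∀ l m i j, i < l → j < m → β (l, m) (i, j) =
      (p l i : k) * (p j m : k) * β (i, j) (l, m)
        + ((lam : k) - 1) * (p l i : k) * β (i, m) (l, j)) ∧
    (∀ l m i j, i < l → m ≤ j → β (l, m) (i, j) =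
      (lam : k) * (p l i : k) * (p j m : k) * β (i, j) (l, m)) ∧
    (∀ i m j, j < m → β (i, m) (i, j) = (p j m : k) * β (i, j) (i, m))}
  add_mem' := by
    rintro β γ ⟨h1, h2, h3⟩ ⟨g1, g2, g3⟩
    refine ⟨fun l m i j hl hm => ?_, fun l m i j hl hm => ?_, fun i m j hm => ?_⟩
    · simp only [Matrix.add_apply, h1 l m i j hl hm, g1 l m i j hl hm]; ring
    · simp only [Matrix.add_apply, h2 l m i j hl hm, g2 l m i j hl hm]; ring
    · simp only [Matrix.add_apply, h3 i m j hm, g3 i m j hm]; ring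
  zero_mem' := by simp
  smul_mem' := by
    rintro c β ⟨h1, h2, h3⟩
    refine ⟨fun l m i j hl hm => ?_, fun l m i j hl hm => ?_, fun i m j hm => ?_⟩
    · simp only [Matrix.smul_apply, smul_eq_mul, h1 l m i j hl hm]; ring
    · simp only [Matrix.smul_apply, smul_eq_mul, h2 l m i j hl hm]; ring
    · simp only [Matrix.smul_apply, smul_eq_mul, h3 i m j hm]; ring

section Forms

variable {k : Type*} [Field k] {n : ℕ} {lam : kˣ} {p : Matrix (Fin n) (Fin n) kˣ}

theorem squareForm_mem (a : Fin n × Fin n) :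
    Matrix.single a a (1 : k) ∈ quadraticDual lam p := by
  obtain ⟨a, b⟩ := a
  refine ⟨fun l m i j hl hm => ?_, fun l m i j hl hm => ?_, fun i m j hm => ?_⟩ <;>
  · simp only [Matrix.single_apply, Prod.mk.injEq]
    grind (splits := 40)

/-- The form dual to the monomial `X_{ij} X_{im}`; likewise for the forms below, each of which is
dual to an ordered monomial in two distinct generators. -/
theorem rowForm_mem (i : Fin n) {j m : Fin n} (h : j < m) :
    Matrix.single (i, j) (i, m) (1 : k) + Matrix.single (i, m) (i, j) (p j m : k) ∈
      quadraticDual lam p := by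
  refine ⟨fun l m i j hl hm => ?_, fun l m i j hl hm => ?_, fun i m j hm => ?_⟩ <;>
  · simp only [Matrix.single_apply, Matrix.add_apply, Prod.mk.injEq]
    grind (splits := 40)

theorem colForm_mem (hp : IsMultiplicativelyAntisymmetric p) {i l : Fin n} (j : Fin n)
    (h : i < l) :
    Matrix.single (i, j) (l, j) (1 : k) + Matrix.single (l, j) (i, j) (lam * p l i : k) ∈
      quadraticDual lam p := by
  have hj : (p j j : k) = 1 := by rw [hp.1]; rfl
  refine ⟨fun l m i j hl hm => ?_, fun l m i j hl hm => ?_, fun i m j hm => ?_⟩ <;>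
  · simp only [Matrix.single_apply, Matrix.add_apply, Prod.mk.injEq]
    grind (splits := 40)

theorem diagForm_mem {i l j m : Fin n} (h : i < l) (h' : j < m) :
    Matrix.single (i, j) (l, m) (1 : k) + Matrix.single (l, m) (i, j) (p l i * p j m : k) ∈
      quadraticDual lam p := by
  refine ⟨fun l m i j hl hm => ?_, fun l m i j hl hm => ?_, fun i m j hm => ?_⟩ <;>
  · simp only [Matrix.single_apply, Matrix.add_apply, Prod.mk.injEq]
    grind (splits := 40)

theorem antiForm_mem {i l j m : Fin n} (h : i < l) (h' : j < m) :
    Matrix.single (i, m) (l, j) (1 : k) + Matrix.single (l, j) (i, m) (lam * p l i * p m j : k) +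
      Matrix.single (l, m) (i, j) ((lam - 1) * p l i : k) ∈ quadraticDual lam p := by
  refine ⟨fun l m i j hl hm => ?_, fun l m i j hl hm => ?_, fun i m j hm => ?_⟩ <;>
  · simp only [Matrix.single_apply, Matrix.add_apply, Prod.mk.injEq]
    grind (splits := 40)

end Forms

/-! ### Derivations of degree zero -/

section Derivation

variable {k : Type*} [Field k] {n : ℕ} {lam : kˣ} {p : Matrix (Fin n) (Fin n) kˣ}

/-- For a derivation `D`, all off-diagonal entries inside a `2 × 2` submatrix vanish. Evaluating the
derived relations of the submatrix on dual forms gives each entry one or two scalar equations, which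
have only the zero solution unless `lam = 1`. -/
theorem rect_eq_zero (hlam : lam ≠ 1)
    (hp : IsMultiplicativelyAntisymmetric p) {D : Matrix (Fin n × Fin n) (Fin n × Fin n) k}
    (hD : ∀ β ∈ quadraticDual lam p, D.transpose * β + β * D ∈ quadraticDual lam p)
    {i l j m : Fin n} (hi : i < l) (hj : j < m) :
    (D (i, m) (l, j) = 0 ∧ D (l, j) (i, m) = 0 ∧ D (i, j) (l, m) = 0 ∧ D (l, m) (i, j) = 0) ∧
    (D (i, j) (i, m) = 0 ∧ D (i, m) (i, j) = 0 ∧ D (l, j) (l, m) = 0 ∧ D (l, m) (l, j) = 0) ∧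
    (D (i, j) (l, j) = 0 ∧ D (l, j) (i, j) = 0 ∧ D (i, m) (l, m) = 0 ∧
      D (l, m) (i, m) = 0) := by
  have hi1 := hi.ne
  have hi2 := hi.ne'
  have hj1 := hj.ne
  have hj2 := hj.ne'
  have hpj (j) : (p j j : k) = 1 := by rw [hp.1]; rfl
  have hl1 : (lam : k) - 1 ≠ 0 := fun h => hlam (Units.ext (by simpa using sub_eq_zero.1 h))
  have hs0 : (p l i : k) ≠ 0 := (p l i).ne_zero
  have ht0 : (p j m : k) ≠ 0 := (p j m).ne_zero
  -- The submatrix is named `A B` (row `i`) over `C E` (row `l`), with columns `j` and `m`.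
  have sqA := hD _ (squareForm_mem (i, j))
  have sqB := hD _ (squareForm_mem (i, m))
  have sqC := hD _ (squareForm_mem (l, j))
  have sqE := hD _ (squareForm_mem (l, m))
  have rAB := hD _ (rowForm_mem i hj)
  have rCE := hD _ (rowForm_mem l hj)
  have cAC := hD _ (colForm_mem hp j hi)
  have cBE := hD _ (colForm_mem hp m hi)
  have dAE := hD _ (diagForm_mem hi hj)
  have e1 := sqC.1 l m i j hi hj
  have e2 := sqB.1 l m i j hi hj
  have e3 := sqE.1 l m i j hi hj
  have e4 := cBE.2.2 i m j hj
  have e5 := sqA.1 l m i j hi hj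
  have e6 := rAB.2.1 l m i m hi le_rfl
  have e7 := sqE.2.2 l m j hj
  have e8 := dAE.2.1 l j i j hi le_rfl
  have e9 := sqB.2.2 i m j hj
  have e10 := cBE.1 l m i j hi hj
  have e11 := sqC.2.2 l m j hj
  have e12 := sqA.2.2 i m j hj
  have e13 := dAE.2.1 l m i m hi le_rfl
  have e14 := cAC.1 l m i j hi hj
  have e15 := sqC.2.1 l j i j hi le_rfl
  have e16 := sqE.2.1 l m i m hi le_rfl
  have e17 := dAE.2.2 i m j hj
  have e18 := rCE.1 l m i j hi hj
  have e19 := sqA.2.1 l j i j hi le_rfl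
  have e20 := sqB.2.1 l m i m hi le_rfl
  have e21 := dAE.2.2 l m j hj
  have e22 := rAB.1 l m i j hi hj
  clear sqA sqB sqC sqE rAB rCE cAC cBE dAE hD
  simp [Matrix.mul_add, Matrix.add_mul, hi1, hi2, hj1,
    hj2, hpj, -mul_eq_mul_left_iff, -mul_eq_mul_right_iff, -mul_eq_zero, -zero_eq_mul]
    at e1 e2 e3 e4 e5 e6 e7 e8 e9 e10 e11 e12 e13 e14 e15 e16 e17 e18 e19 e20 e21 e22
  generalize (lam : k) = t at *
  generalize (p l i : k) = s at *
  generalize (p j m : k) = r at *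
  have key {x : k} (h : (t - 1) * x = 0) : x = 0 := (mul_eq_zero.1 h).resolve_left hl1
  have keys {x : k} (h : (t - 1) * (s * x) = 0) : x = 0 :=
    (mul_eq_zero.1 (key h)).resolve_left hs0
  have keyr {x : k} (h : (t - 1) * (r * x) = 0) : x = 0 :=
    (mul_eq_zero.1 (key h)).resolve_left ht0
  -- In each equation with two unknown entries, one of them has already been shown to vanish.
  have z8 : D (l, m) (l, j) = 0 := keys (by linear_combination -s * e7 - e8)
  have z13 : D (i, j) (i, m) = 0 := keys (by linear_combination -s * e12 - e13)
  have z17 : D (l, m) (i, m) = 0 := keyr (by linear_combination -r * e16 - t * e17)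
  have z21 : D (i, j) (l, j) = 0 := keyr (by linear_combination -r * e19 - t * e21)
  rw [z8] at e10
  rw [z13] at e14
  rw [z17] at e18
  rw [z21] at e22
  refine ⟨⟨keys ?_, keys ?_, key ?_, key ?_⟩, ⟨z13, keys ?_, keys ?_, z8⟩,
    z21, keyr ?_, keyr ?_, z17⟩
  · linear_combination -e2
  · linear_combination -e1
  · linear_combination t * e5 - e6
  · linear_combination t * e3 - e4
  · linear_combination e10 - s * e9
  · linear_combination e14 - s * e11
  · linear_combination t * e18 - r * e15
  · linear_combination t * e22 - r * e20

/-- Derivations of degree zero are diagonal when `lam ≠ 1` and `2 ≤ n`. -/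
theorem eq_zero_of_ne (hlam : lam ≠ 1) (hn : 2 ≤ n)
    (hp : IsMultiplicativelyAntisymmetric p) {D : Matrix (Fin n × Fin n) (Fin n × Fin n) k}
    (hD : ∀ β ∈ quadraticDual lam p, D.transpose * β + β * D ∈ quadraticDual lam p)
    {a b : Fin n × Fin n} (hab : a ≠ b) : D a b = 0 := by
  have : Nontrivial (Fin n) := Fin.nontrivial_iff_two_le.2 hn
  obtain ⟨i, j⟩ := a
  obtain ⟨l, m⟩ := b
  rcases lt_trichotomy i l with hi | rfl | hi
  · rcases lt_trichotomy j m with hj | rfl | hj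
    · exact (rect_eq_zero hlam hp hD hi hj).1.2.2.1
    · obtain ⟨m, hm⟩ := exists_ne j
      rcases lt_or_gt_of_ne hm with hj | hj
      · exact (rect_eq_zero hlam hp hD hi hj).2.2.2.2.1
      · exact (rect_eq_zero hlam hp hD hi hj).2.2.1
    · exact (rect_eq_zero hlam hp hD hi hj).1.1
  · obtain ⟨l, hl⟩ := exists_ne i
    rcases lt_trichotomy j m with hj | rfl | hj
    · rcases lt_or_gt_of_ne hl with hi | hi
      · exact (rect_eq_zero hlam hp hD hi hj).2.1.2.2.1
      · exact (rect_eq_zero hlam hp hD hi hj).2.1.1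
    · exact absurd rfl hab
    · rcases lt_or_gt_of_ne hl with hi | hi
      · exact (rect_eq_zero hlam hp hD hi hj).2.1.2.2.2
      · exact (rect_eq_zero hlam hp hD hi hj).2.1.2.1
  · rcases lt_trichotomy j m with hj | rfl | hj
    · exact (rect_eq_zero hlam hp hD hi hj).1.2.1
    · obtain ⟨m, hm⟩ := exists_ne j
      rcases lt_or_gt_of_ne hm with hj | hj
      · exact (rect_eq_zero hlam hp hD hi hj).2.2.2.2.2
      · exact (rect_eq_zero hlam hp hD hi hj).2.2.2.1
    · exact (rect_eq_zero hlam hp hD hi hj).1.2.2.2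

end Derivation

/-! ### Rectangle-preserving permutations of the grid -/

section Combinatorics

variable {n : ℕ}

/-- The positions `c` and `d` are the antidiagonal corners of a rectangle with sides of positive
length. -/
def IsAntidiagonal (c d : Fin n × Fin n) : Prop :=
  (c.1 < d.1 ∧ d.2 < c.2) ∨ (d.1 < c.1 ∧ c.2 < d.2)

/-- `w` maps the corners of each rectangle to the corners of a rectangle, antidiagonal corners to
antidiagonal corners. The image may be transposed or turned. -/
def PreservesRectangles (w : Fin n × Fin n → Fin n × Fin n) : Prop :=
  ∀ i l j m, i < l → j < m → IsAntidiagonal (w (i, m)) (w (l, j)) ∧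
    ((w (i, j) = ((w (i, m)).1, (w (l, j)).2) ∧ w (l, m) = ((w (l, j)).1, (w (i, m)).2)) ∨
     (w (i, j) = ((w (l, j)).1, (w (i, m)).2) ∧ w (l, m) = ((w (i, m)).1, (w (l, j)).2)))

theorem PreservesRectangles.swap {w : Fin n × Fin n → Fin n × Fin n}
    (h : PreservesRectangles w) : PreservesRectangles (fun x => (w x).swap) := by
  intro i l j m hi hj
  obtain ⟨h1, h2⟩ := h i l j m hi hj
  refine ⟨?_, ?_⟩
  · simp only [IsAntidiagonal, Prod.fst_swap, Prod.snd_swap] at h1 ⊢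
    tauto
  · rcases h2 with ⟨h2, h3⟩ | ⟨h2, h3⟩
    · exact Or.inr ⟨by simp [h2], by simp [h3]⟩
    · exact Or.inl ⟨by simp [h2], by simp [h3]⟩

theorem eq_id_of_strictMono {f : Fin n → Fin n} (hf : StrictMono f) (i : Fin n) : f i = i :=
  le_antisymm hf.apply_le hf.le_apply

theorem eq_rev_of_strictAnti {f : Fin n → Fin n} (hf : StrictAnti f) (i : Fin n) :
    f i = i.rev :=
  Fin.rev_injective (by simpa using eq_id_of_strictMono (Fin.rev_strictAnti.comp hf) i)

/-- Either rows go to rows and columns to columns, or rows go to columns and columns to rows: at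
this stage the alternative still depends on the rectangle. -/
theorem PreservesRectangles.edge {w : Fin n × Fin n → Fin n × Fin n}
    (h : PreservesRectangles w) {i l j m : Fin n} (hi : i ≠ l) (hj : j ≠ m) :
    ((w (i, j)).1 = (w (i, m)).1 ∧ (w (i, j)).2 = (w (l, j)).2) ∨
    ((w (i, j)).2 = (w (i, m)).2 ∧ (w (i, j)).1 = (w (l, j)).1) := by
  rcases lt_or_gt_of_ne hi with hi | hi <;> rcases lt_or_gt_of_ne hj with hj | hj
  all_goals
    rcases (h _ _ _ _ hi hj).2 with ⟨h1, h2⟩ | ⟨h1, h2⟩ <;> simp [h1, h2]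

/-- If one horizontal pair stays horizontal, then so does every other, because two rectangles with
a common edge are of the same kind. So `w` acts on rows and columns separately, and both
actions are monotone in the same direction. -/
theorem PreservesRectangles.eq_of_row {w : Fin n × Fin n → Fin n × Fin n}
    (h : PreservesRectangles w) (hw : Function.Injective w) {i₀ j₀ m₀ : Fin n}
    (hn : 2 ≤ n) (hj : j₀ ≠ m₀) (h0 : (w (i₀, j₀)).1 = (w (i₀, m₀)).1) :
    (∀ i j, w (i, j) = (i, j)) ∨ (∀ i j, w (i, j) = (i.rev, j.rev)) := by
  have hnt : Nontrivial (Fin n) := Fin.nontrivial_iff_two_le.2 hn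
  have key : ∀ i l j m, i ≠ l → j ≠ m →
      ((w (i, j)).1 = (w (i, m)).1 ↔ (w (i, j)).2 = (w (l, j)).2) := by
    intro i l j m hi hj
    have hjm : w (i, j) ≠ w (i, m) := fun e => hj (by simpa using hw e)
    have hil : w (i, j) ≠ w (l, j) := fun e => hi (by simpa using hw e)
    rcases h.edge hi hj with ⟨h1, h2⟩ | ⟨h1, h2⟩
    · simp [h1, h2]
    · exact ⟨fun h3 => absurd (Prod.ext h3 h1) hjm, fun h3 => absurd (Prod.ext h2 h3) hil⟩
  have hC : ∀ l, l ≠ i₀ → (w (i₀, j₀)).2 = (w (l, j₀)).2 := fun l hl =>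
    (key i₀ l j₀ m₀ hl.symm hj).1 h0
  have hR0 : ∀ i m, (w (i, j₀)).1 = (w (i, m)).1 := by
    intro i m
    rcases eq_or_ne j₀ m with rfl | hm
    · rfl
    · rcases eq_or_ne i i₀ with rfl | hi
      · obtain ⟨l, hl⟩ := exists_ne i
        exact (key i l j₀ m hl.symm hm).2 (hC l hl)
      · exact (key i i₀ j₀ m hi hm).2 (hC i hi).symm
  have hR : ∀ i j m, (w (i, j)).1 = (w (i, m)).1 := fun i j m => (hR0 i j).symm.trans (hR0 i m)
  have hC : ∀ i l j, (w (i, j)).2 = (w (l, j)).2 := by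
    intro i l j
    rcases eq_or_ne i l with rfl | hi
    · rfl
    · obtain ⟨m, hm⟩ := exists_ne j
      exact (key i l j m hi hm.symm).1 (hR i j m)
  set f : Fin n → Fin n := fun i => (w (i, j₀)).1
  set g : Fin n → Fin n := fun j => (w (i₀, j)).2
  have hfg : ∀ i j, w (i, j) = (f i, g j) := fun i j => Prod.ext (hR _ _ _) (hC _ _ _)
  have hmono : ∀ i l j m, i < l → j < m →
      (f i < f l ∧ g j < g m) ∨ (f l < f i ∧ g m < g j) := by
    intro i l j m hi hj
    simpa [IsAntidiagonal, hfg] using (h i l j m hi hj).1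
  obtain ⟨a, b, hab⟩ := exists_pair_lt (Fin n)
  rcases hmono a b a b hab hab with h1 | h1
  · have hg : StrictMono g := fun j m hj => by
      rcases hmono a b j m hab hj with h2 | h2
      · exact h2.2
      · exact absurd h1.1 h2.1.not_gt
    have hf : StrictMono f := fun i l hi => by
      rcases hmono i l a b hi hab with h2 | h2
      · exact h2.1
      · exact absurd h1.2 h2.2.not_gt
    left
    intro i j
    rw [hfg, eq_id_of_strictMono hf, eq_id_of_strictMono hg]
  · have hg : StrictAnti g := fun j m hj => by
      rcases hmono a b j m hab hj with h2 | h2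
      · exact absurd h1.1 h2.1.not_gt
      · exact h2.2
    have hf : StrictAnti f := fun i l hi => by
      rcases hmono i l a b hi hab with h2 | h2
      · exact absurd h1.2 h2.2.not_gt
      · exact h2.1
    right
    intro i j
    rw [hfg, eq_rev_of_strictAnti hf, eq_rev_of_strictAnti hg]

theorem PreservesRectangles.classification {w : Fin n × Fin n → Fin n × Fin n}
    (h : PreservesRectangles w) (hw : Function.Injective w) (hn : 2 ≤ n) :
    (∀ i j, w (i, j) = (i, j)) ∨ (∀ i j, w (i, j) = (j, i)) ∨
      (∀ i j, w (i, j) = (i.rev, j.rev)) ∨ (∀ i j, w (i, j) = (j.rev, i.rev)) := by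
  have hnt : Nontrivial (Fin n) := Fin.nontrivial_iff_two_le.2 hn
  obtain ⟨a, b, hab⟩ := exists_pair_ne (Fin n)
  rcases h.edge hab hab with ⟨h0, -⟩ | ⟨h0, -⟩
  · rcases h.eq_of_row hw hn hab h0 with h1 | h1
    · exact Or.inl h1
    · exact Or.inr (Or.inr (Or.inl h1))
  · rcases h.swap.eq_of_row (Prod.swap_injective.comp hw) hn hab h0 with h1 | h1
    · exact Or.inr (Or.inl fun i j => Prod.swap_injective (h1 i j))
    · exact Or.inr (Or.inr (Or.inr fun i j => Prod.swap_injective (h1 i j)))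

end Combinatorics

/-! ### Linear isomorphisms of the relations are monomial -/

section Congruence

variable {k : Type*} [Field k] {n : ℕ} {lam mu : kˣ} {p q : Matrix (Fin n) (Fin n) kˣ}

/-- The diagonal derivation of weight `r` on rows and `s` on columns; it exists because the relations
are homogeneous for the bigrading by rows and columns. -/
theorem diagonal_mem (r s : Fin n → k) {β : Matrix (Fin n × Fin n) (Fin n × Fin n) k}
    (hβ : β ∈ quadraticDual lam p) :
    (Matrix.diagonal fun a : Fin n × Fin n => r a.1 + s a.2).transpose * β +
      β * (Matrix.diagonal fun a : Fin n × Fin n => r a.1 + s a.2) ∈ quadraticDual lam p := by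
  obtain ⟨h1, h2, h3⟩ := hβ
  refine ⟨fun l m i j hl hm => ?_, fun l m i j hl hm => ?_, fun i m j hm => ?_⟩ <;>
  simp only [Matrix.diagonal_transpose, Matrix.add_apply, Matrix.diagonal_mul,
    Matrix.mul_diagonal]
  · rw [h1 l m i j hl hm]; ring
  · rw [h2 l m i j hl hm]; ring
  · rw [h3 i m j hm]; ring

/-- A linear isomorphism between the spaces of relations is a rescaled permutation of the
generators: it conjugates the diagonal derivations on one side into diagonal matrices. Only
`lam ≠ 1` is needed, not `mu ≠ 1`. -/
theorem exists_monomial (hn : 2 ≤ n) (hlam : lam ≠ 1)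
    (hp : IsMultiplicativelyAntisymmetric p)
    {L : Matrix (Fin n × Fin n) (Fin n × Fin n) k} (hL : IsUnit L)
    (hmap : ∀ β ∈ quadraticDual mu q, L.transpose * β * L ∈ quadraticDual lam p)
    (hsurj : ∀ γ ∈ quadraticDual lam p, ∃ β ∈ quadraticDual mu q, L.transpose * β * L = γ) :
    ∃ (w : Fin n × Fin n → Fin n × Fin n) (c : Fin n × Fin n → k), Function.Injective w ∧
      (∀ a, c a ≠ 0) ∧ ∀ b a, L b a = if b = w a then c a else 0 := by
  obtain ⟨M, hLM, hML⟩ := isUnit_iff_exists.1 hL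
  have hdiag : ∀ r s : Fin n → k, ∀ b a, L b a ≠ 0 →
      r b.1 + s b.2 =
        (M * (Matrix.diagonal fun a : Fin n × Fin n => r a.1 + s a.2) * L) a a := by
    intro r s b a hba
    set E := Matrix.diagonal fun a : Fin n × Fin n => r a.1 + s a.2 with hE
    set D := M * E * L with hD
    have hLD : L * D = E * L := by
      rw [hD, ← Matrix.mul_assoc, ← Matrix.mul_assoc, hLM, Matrix.one_mul]
    have hder : ∀ γ ∈ quadraticDual lam p, D.transpose * γ + γ * D ∈ quadraticDual lam p := by
      intro γ hγ
      obtain ⟨β, hβ, rfl⟩ := hsurj γ hγ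
      have := hmap _ (diagonal_mem r s hβ)
      convert this using 1
      rw [← hE, Matrix.mul_add, Matrix.add_mul]
      congr 1
      · rw [← Matrix.mul_assoc, ← Matrix.mul_assoc, ← Matrix.mul_assoc, ← Matrix.transpose_mul,
          hLD, Matrix.transpose_mul]
      · rw [Matrix.mul_assoc, hLD, Matrix.mul_assoc, Matrix.mul_assoc, Matrix.mul_assoc]
    have h1 : (L * D) b a = L b a * D a a := by
      rw [Matrix.mul_apply, Finset.sum_eq_single a]
      · intro x _ hx
        rw [eq_zero_of_ne hlam hn hp hder hx, mul_zero]
      · simp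
    rw [hLD, hE, Matrix.diagonal_mul, mul_comm] at h1
    exact mul_left_cancel₀ hba h1
  have huniq : ∀ a b b', L b a ≠ 0 → L b' a ≠ 0 → b = b' := by
    intro a b b' hb hb'
    ext1
    · have h1 := (hdiag (Pi.single b.1 1) 0 b a hb).trans (hdiag (Pi.single b.1 1) 0 b' a hb').symm
      by_contra hne
      simp [Ne.symm hne] at h1
    · have h1 := (hdiag 0 (Pi.single b.2 1) b a hb).trans (hdiag 0 (Pi.single b.2 1) b' a hb').symm
      by_contra hne
      simp [Ne.symm hne] at h1
  have hex : ∀ a, ∃ b, L b a ≠ 0 := by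
    intro a
    by_contra! h
    have h1 : (M * L) a a = 0 := by simp [Matrix.mul_apply, h]
    simp [hML] at h1
  choose w hw using hex
  have hval : ∀ b a, L b a = if b = w a then L (w a) a else 0 := by
    intro b a
    split_ifs with h
    · rw [h]
    · by_contra h2
      exact h (huniq a b (w a) h2 (hw a))
  refine ⟨w, fun a => L (w a) a, fun a a' haa => ?_, hw, hval⟩
  have h1 : ∀ x, (M * L) x a * L (w a') a' = (M * L) x a' * L (w a) a := by
    intro x
    have h2 : ∀ a, (M * L) x a = M x (w a) * L (w a) a := by
      intro a
      rw [Matrix.mul_apply, Finset.sum_eq_single (w a)]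
      · intro y _ hy
        rw [hval y a, if_neg hy, mul_zero]
      · simp
    rw [h2, h2, haa]; ring
  -- Two columns of `L` supported in the same row are proportional; so are those of `M * L = 1`.
  by_contra hne
  have := h1 a
  simp [hML, hne] at this
  exact hw a' this

/-- For distinct positions `c`, `d` there is a form in the quadratic dual that is nonzero at `(c, d)`
and is supported on the two orders of this pair and, if the pair is antidiagonal, on the opposite
diagonal. -/
theorem exists_form (hq : IsMultiplicativelyAntisymmetric q) {c d : Fin n × Fin n} (hcd : c ≠ d) :
    ∃ β ∈ quadraticDual mu q, β c d ≠ 0 ∧ ∀ x y, β x y ≠ 0 →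
      (x = c ∧ y = d) ∨ (x = d ∧ y = c) ∨ (IsAntidiagonal c d ∧
        ((x = (c.1, d.2) ∧ y = (d.1, c.2)) ∨ (x = (d.1, c.2) ∧ y = (c.1, d.2)))) := by
  obtain ⟨i, j⟩ := c
  obtain ⟨l, m⟩ := d
  have hu (x : kˣ) : (x : k) ≠ 0 := x.ne_zero
  rcases lt_trichotomy i l with hi | rfl | hi
  · rcases lt_trichotomy j m with hj | rfl | hj
    · refine ⟨_, diagForm_mem hi hj, ?_, fun x y hxy => ?_⟩
      · simp [hi.ne, hi.ne']
      · simp only [Matrix.add_apply, Matrix.single_apply] at hxy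
        grind
    · refine ⟨_, colForm_mem hq j hi, ?_, fun x y hxy => ?_⟩
      · simp [hi.ne, hi.ne']
      · simp only [Matrix.add_apply, Matrix.single_apply] at hxy
        grind
    · refine ⟨_, antiForm_mem hi hj, ?_, fun x y hxy => ?_⟩
      · simp [hi.ne, hi.ne']
      · simp only [Matrix.add_apply, Matrix.single_apply, IsAntidiagonal] at hxy ⊢
        grind
  · rcases lt_trichotomy j m with hj | rfl | hj
    · refine ⟨_, rowForm_mem i hj, ?_, fun x y hxy => ?_⟩
      · simp [hj.ne, hj.ne']
      · simp only [Matrix.add_apply, Matrix.single_apply] at hxy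
        grind
    · exact absurd rfl hcd
    · refine ⟨_, rowForm_mem i hj, ?_, fun x y hxy => ?_⟩
      · simp [hj.ne, hj.ne']
      · simp only [Matrix.add_apply, Matrix.single_apply] at hxy
        grind
  · rcases lt_trichotomy j m with hj | rfl | hj
    · refine ⟨_, antiForm_mem hi hj, ?_, fun x y hxy => ?_⟩
      · simp [hi.ne, hi.ne', hj.ne]
      · simp only [Matrix.add_apply, Matrix.single_apply, IsAntidiagonal] at hxy ⊢
        grind
    · refine ⟨_, colForm_mem hq j hi, ?_, fun x y hxy => ?_⟩
      · simp [hi.ne, hi.ne']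
      · simp only [Matrix.add_apply, Matrix.single_apply] at hxy
        grind
    · refine ⟨_, diagForm_mem hi hj, ?_, fun x y hxy => ?_⟩
      · simp [hi.ne, hi.ne']
      · simp only [Matrix.add_apply, Matrix.single_apply] at hxy
        grind

/-- The cross relation has a nonzero antidiagonal term, so a form detecting the image of that term
must also detect the image of the diagonal. -/
theorem preservesRectangles_of_monomial (hlam : lam ≠ 1)
    (hq : IsMultiplicativelyAntisymmetric q)
    {w : Fin n × Fin n → Fin n × Fin n} {c : Fin n × Fin n → k}
    (hw : Function.Injective w) (hc : ∀ a, c a ≠ 0)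
    (hmap : ∀ β ∈ quadraticDual mu q,
      (Matrix.of fun a b => c a * c b * β (w a) (w b)) ∈ quadraticDual lam p) :
    PreservesRectangles w := by
  intro i l j m hi hj
  have hl1 : (lam : k) - 1 ≠ 0 := fun h => hlam (Units.ext (by simpa using sub_eq_zero.1 h))
  have hne : w (i, m) ≠ w (l, j) := fun h => hi.ne (congrArg Prod.fst (hw h))
  have n1 : w (i, j) ≠ w (i, m) := fun h => hj.ne (congrArg Prod.snd (hw h))
  have n2 : w (i, j) ≠ w (l, j) := fun h => hi.ne (congrArg Prod.fst (hw h))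
  obtain ⟨β, hβ, h0, hsupp⟩ := exists_form (mu := mu) hq hne
  have h1 := (hmap β hβ).1 l m i j hi hj
  simp only [Matrix.of_apply] at h1
  have h2 : β (w (l, m)) (w (i, j)) ≠ 0 ∨ β (w (i, j)) (w (l, m)) ≠ 0 := by
    by_contra! h
    rw [h.1, h.2] at h1
    have : (lam - 1 : k) * (p l i : k) * (c (i, m) * c (l, j) * β (w (i, m)) (w (l, j))) ≠ 0 := by
      simp [hl1, hc, h0]
    apply this
    linear_combination -h1
  rcases h2 with h2 | h2
  · have := hsupp _ _ h2
    tauto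
  · have := hsupp _ _ h2
    tauto

/-- The congruence action of a monomial matrix. -/
theorem map_form_eq {L : Matrix (Fin n × Fin n) (Fin n × Fin n) k}
    {w : Fin n × Fin n → Fin n × Fin n} {c : Fin n × Fin n → k}
    (hL : ∀ b a, L b a = if b = w a then c a else 0)
    (β : Matrix (Fin n × Fin n) (Fin n × Fin n) k) :
    L.transpose * β * L = Matrix.of fun a b => c a * c b * β (w a) (w b) := by
  ext a b
  simp only [Matrix.mul_apply, Matrix.transpose_apply, hL, Matrix.of_apply, ite_mul, zero_mul,
    Finset.sum_ite_eq', Finset.mem_univ, if_true, mul_ite, mul_zero]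
  ring

end Congruence

/-! ### Reading off the parameters -/

section Parameters

variable {k : Type*} [Field k] {n : ℕ} {lam mu : kˣ} {p q : Matrix (Fin n) (Fin n) kˣ}

theorem _root_.IsMultiplicativelyAntisymmetric.mul_eq_one
    (hp : IsMultiplicativelyAntisymmetric p) (i j : Fin n) : p i j * p j i = 1 := by
  rcases eq_or_ne i j with rfl | h
  · simp [hp.1]
  · rw [hp.2 i j h, inv_mul_cancel]

theorem _root_.IsMultiplicativelyAntisymmetric.ext_of_lt
    (hp : IsMultiplicativelyAntisymmetric p) (hq : IsMultiplicativelyAntisymmetric q)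
    (h : ∀ i j, i < j → p i j = q i j) (i j : Fin n) : p i j = q i j := by
  rcases lt_trichotomy i j with hij | rfl | hij
  · exact h i j hij
  · rw [hp.1, hq.1]
  · rw [hp.2 i j hij.ne', hq.2 i j hij.ne', h j i hij]

/-- Comparing, for each of the four permutations, the commutation constants of two generators in a
common row and of two generators in a common column. -/
theorem parameters_of_monomial (hn : 2 ≤ n)
    (hp : IsMultiplicativelyAntisymmetric p) (hq : IsMultiplicativelyAntisymmetric q)
    {w : Fin n × Fin n → Fin n × Fin n} {c : Fin n × Fin n → k} (hc : ∀ a, c a ≠ 0)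
    (hmap : ∀ β ∈ quadraticDual mu q,
      (Matrix.of fun a b => c a * c b * β (w a) (w b)) ∈ quadraticDual lam p)
    (hw : (∀ i j, w (i, j) = (i, j)) ∨ (∀ i j, w (i, j) = (j, i)) ∨
      (∀ i j, w (i, j) = (i.rev, j.rev)) ∨ (∀ i j, w (i, j) = (j.rev, i.rev))) :
    (lam = mu ∧ ∀ i j, p i j = q i j) ∨
      (lam = mu ∧ ∀ i j, j < i → p i j = lam⁻¹ * q j i) ∨
      (lam = mu⁻¹ ∧ ∀ i j, p i j = q i.rev j.rev) ∨
      (lam = mu⁻¹ ∧ ∀ i j, j < i → p i j = lam⁻¹ * q j.rev i.rev) := by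
  have hnt : Nontrivial (Fin n) := Fin.nontrivial_iff_two_le.2 hn
  obtain ⟨a, b, hab⟩ := exists_pair_lt (Fin n)
  have hrow : ∀ β ∈ quadraticDual mu q, ∀ i m j, j < m →
      β (w (i, m)) (w (i, j)) = (p j m : k) * β (w (i, j)) (w (i, m)) := by
    intro β hβ i m j hj
    apply mul_left_cancel₀ (mul_ne_zero (hc (i, m)) (hc (i, j)))
    have := (hmap β hβ).2.2 i m j hj
    simp only [Matrix.of_apply] at this
    linear_combination this
  have hcol : ∀ β ∈ quadraticDual mu q, ∀ l m i, i < l →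
      β (w (l, m)) (w (i, m)) = (lam * p l i : k) * β (w (i, m)) (w (l, m)) := by
    intro β hβ l m i hi
    apply mul_left_cancel₀ (mul_ne_zero (hc (l, m)) (hc (i, m)))
    have := (hmap β hβ).2.1 l m i m hi le_rfl
    simp only [Matrix.of_apply, hp.1, Units.val_one, mul_one] at this
    linear_combination this
  rcases hw with hw | hw | hw | hw <;> simp only [hw] at hrow hcol
  · have h1 : ∀ j m, j < m → p j m = q j m := fun j m hj => by
      have := hrow _ (rowForm_mem a hj) a m j hj
      simp [hj.ne, hj.ne'] at this
      exact Units.ext this.symm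
    have h2 := hcol _ (colForm_mem hq a hab) b a a hab
    simp [hab.ne, hab.ne', ← Units.val_mul] at h2
    have h3 := hp.ext_of_lt hq h1
    refine Or.inl ⟨?_, h3⟩
    rw [h3 b a] at h2
    exact (mul_right_cancel (Units.ext h2)).symm
  · have h1 := hrow _ (colForm_mem hq a hab) a b a hab
    simp [hab.ne, hab.ne', ← Units.val_mul] at h1
    have h2 : ∀ i l, i < l → q i l = lam * p l i := fun i l hi => by
      have := hcol _ (rowForm_mem a hi) l a i hi
      simp [hi.ne, hi.ne', ← Units.val_mul] at this
      exact Units.ext this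
    have h1 := Units.ext h1
    refine Or.inr (Or.inl ⟨?_, fun i j hij => ?_⟩)
    · calc lam = lam * p b a * p a b := by rw [mul_assoc, hp.mul_eq_one, mul_one]
        _ = mu * (q b a * q a b) := by rw [← h2 a b hab, ← h1, mul_comm, mul_assoc]
        _ = mu := by rw [hq.mul_eq_one, mul_one]
    · rw [h2 j i hij, inv_mul_cancel_left]
  · have h1 : ∀ j m, j < m → p j m = q j.rev m.rev := fun j m hj => by
      have hj' : m.rev < j.rev := Fin.rev_lt_rev.2 hj
      have := hrow _ (rowForm_mem a.rev hj') a m j hj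
      simp [hj.ne, hj.ne', ← Units.val_mul] at this
      have h3 := hq.mul_eq_one m.rev j.rev
      rw [eq_comm] at this
      exact mul_right_cancel ((Units.ext this).trans ((mul_comm _ _).trans h3).symm)
    have h2 := hcol _ (colForm_mem hq a.rev (Fin.rev_lt_rev.2 hab)) b a a hab
    simp [hab.ne, hab.ne', ← Units.val_mul] at h2
    have h3 : ∀ i j, p i j = q i.rev j.rev :=
      hp.ext_of_lt (q := fun i j => q i.rev j.rev)
        ⟨fun i => hq.1 _, fun i j hij => hq.2 _ _ (by simpa using hij)⟩ h1
    refine Or.inr (Or.inr (Or.inl ⟨?_, h3⟩))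
    rw [h3 b a] at h2
    have h4 : 1 = lam * q b.rev a.rev * (mu * q a.rev b.rev) := Units.ext h2
    rw [mul_mul_mul_comm, hq.mul_eq_one, mul_one] at h4
    exact eq_inv_of_mul_eq_one_left h4.symm
  · have h1 := hrow _ (colForm_mem hq a.rev (Fin.rev_lt_rev.2 hab)) a b a hab
    simp [hab.ne, hab.ne', ← Units.val_mul] at h1
    have h2 : ∀ i l, i < l → 1 = lam * p l i * q l.rev i.rev := fun i l hi => by
      have := hcol _ (rowForm_mem a.rev (Fin.rev_lt_rev.2 hi)) l a i hi
      simp [hi.ne, hi.ne', ← Units.val_mul] at this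
      exact Units.ext this
    refine Or.inr (Or.inr (Or.inr ⟨?_, fun i j hij => ?_⟩))
    · have h3 : 1 = p a b * (mu * q a.rev b.rev) := Units.ext h1
      have h4 : lam * mu = 1 := by
        calc lam * mu = lam * mu * (p b a * p a b) * (q a.rev b.rev * q b.rev a.rev) := by
              rw [hp.mul_eq_one, hq.mul_eq_one]; simp
          _ = lam * p b a * q b.rev a.rev * (p a b * (mu * q a.rev b.rev)) := by
              simp only [mul_comm, mul_left_comm]
          _ = 1 := by rw [← h2 a b hab, ← h3, mul_one]
      exact eq_inv_of_mul_eq_one_left h4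
    · have h3 := h2 j i hij
      have h4 := hq.mul_eq_one i.rev j.rev
      rw [eq_inv_mul_iff_mul_eq]
      exact mul_right_cancel (h3.symm.trans ((mul_comm _ _).trans h4).symm)
end Parameters

/-! ### Generators and the universal property -/

section Generators

variable {k : Type*} [Field k] {n : ℕ} {lam mu : kˣ} {p q : Matrix (Fin n) (Fin n) kˣ}

/-- The image of the generator `X_{ij}` in the quantum matrix algebra. -/
def gen (lam : kˣ) (p : Matrix (Fin n) (Fin n) kˣ) (i j : Fin n) : QuantumMatrixAlgebra lam p :=
  RingQuot.mkAlgHom k (Rel lam p) (freeX k i j)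

theorem gen_cross {l m i j : Fin n} (hl : i < l) (hm : j < m) :
    gen lam p l m * gen lam p i j =
      ((p l i : k) * (p j m : k)) • (gen lam p i j * gen lam p l m) +
        (((lam : k) - 1) * (p l i : k)) • (gen lam p i m * gen lam p l j) := by
  simpa only [gen, map_mul, map_add, map_smul] using
    RingQuot.mkAlgHom_rel k (Rel.cross (lam := lam) (p := p) l m i j hl hm)

theorem gen_anti {l m i j : Fin n} (hl : i < l) (hm : m ≤ j) :
    gen lam p l m * gen lam p i j =
      ((lam : k) * (p l i : k) * (p j m : k)) • (gen lam p i j * gen lam p l m) := by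
  simpa only [gen, map_mul, map_add, map_smul] using
    RingQuot.mkAlgHom_rel k (Rel.anti (lam := lam) (p := p) l m i j hl hm)

theorem gen_row {i m j : Fin n} (hm : j < m) :
    gen lam p i m * gen lam p i j = (p j m : k) • (gen lam p i j * gen lam p i m) := by
  simpa only [gen, map_mul, map_add, map_smul] using
    RingQuot.mkAlgHom_rel k (Rel.row (lam := lam) (p := p) i m j hm)

theorem induction_gen {P : QuantumMatrixAlgebra lam p → Prop}
    (halg : ∀ r, P (algebraMap k _ r)) (hgen : ∀ i j, P (gen lam p i j))
    (hmul : ∀ x y, P x → P y → P (x * y)) (hadd : ∀ x y, P x → P y → P (x + y))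
    (x : QuantumMatrixAlgebra lam p) : P x := by
  obtain ⟨x, rfl⟩ := RingQuot.mkAlgHom_surjective k (Rel lam p) x
  induction x using FreeAlgebra.induction with
  | grade0 r => simpa using halg r
  | grade1 a => exact hgen a.1 a.2
  | mul x y hx hy => rw [map_mul]; exact hmul _ _ hx hy
  | add x y hx hy => rw [map_add]; exact hadd _ _ hx hy

/-- The algebra map determined by elements `X i j` satisfying the defining relations. -/
def lift {T : Type*} [Semiring T] [Algebra k T] (X : Fin n → Fin n → T)
    (hcross : ∀ l m i j, i < l → j < m → X l m * X i j =
      ((p l i : k) * (p j m : k)) • (X i j * X l m) +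
        (((lam : k) - 1) * (p l i : k)) • (X i m * X l j))
    (hanti : ∀ l m i j, i < l → m ≤ j → X l m * X i j =
      ((lam : k) * (p l i : k) * (p j m : k)) • (X i j * X l m))
    (hrow : ∀ i m j, j < m → X i m * X i j = (p j m : k) • (X i j * X i m)) :
    QuantumMatrixAlgebra lam p →ₐ[k] T :=
  RingQuot.liftAlgHom k ⟨FreeAlgebra.lift k fun a => X a.1 a.2, by
    rintro _ _ (⟨l, m, i, j, hl, hm⟩ | ⟨l, m, i, j, hl, hm⟩ | ⟨i, m, j, hm⟩)
    · simpa [freeX] using hcross l m i j hl hm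
    · simpa [freeX] using hanti l m i j hl hm
    · simpa [freeX] using hrow i m j hm⟩

@[simp]
theorem lift_gen {T : Type*} [Semiring T] [Algebra k T] (X : Fin n → Fin n → T)
    (hcross) (hanti) (hrow) (i j : Fin n) :
    lift (lam := lam) (p := p) X hcross hanti hrow (gen lam p i j) = X i j := by
  simp [lift, gen, freeX]

theorem algHom_ext {T : Type*} [Semiring T] [Algebra k T]
    {f g : QuantumMatrixAlgebra lam p →ₐ[k] T}
    (h : ∀ i j, f (gen lam p i j) = g (gen lam p i j)) : f = g := by
  ext a
  exact h a.1 a.2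

/-- Every algebra map followed by a linear functional restricts to a form in the quadratic dual. -/
theorem form_mem {T : Type*} [Semiring T] [Algebra k T]
    (f : QuantumMatrixAlgebra lam p →ₐ[k] T) (θ : T →ₗ[k] k) :
    (Matrix.of fun a b : Fin n × Fin n => θ (f (gen lam p a.1 a.2) * f (gen lam p b.1 b.2))) ∈
      quadraticDual lam p := by
  refine ⟨fun l m i j hl hm => ?_, fun l m i j hl hm => ?_, fun i m j hm => ?_⟩
  · simpa using congrArg (fun x => θ (f x)) (gen_cross (lam := lam) (p := p) hl hm)
  · simpa using congrArg (fun x => θ (f x)) (gen_anti (lam := lam) (p := p) hl hm)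
  · simpa using congrArg (fun x => θ (f x)) (gen_row (lam := lam) (p := p) (i := i) hm)

end Generators

/-! ### Transpose and half turn -/

section Symmetries

variable {k : Type*} [Field k] {n : ℕ} {lam mu : kˣ} {p q : Matrix (Fin n) (Fin n) kˣ}

/-- The algebra map `X_{ij} ↦ X_{ji}`. -/
def transposeHom (hp : IsMultiplicativelyAntisymmetric p) (hq : IsMultiplicativelyAntisymmetric q)
    (h : ∀ i j, j < i → p i j = lam⁻¹ * q j i) :
    QuantumMatrixAlgebra lam p →ₐ[k] QuantumMatrixAlgebra lam q :=
  have hlow : ∀ i j, j < i → (lam * p i j : k) = q j i := fun i j hij => by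
    rw [h i j hij, ← Units.val_mul, mul_inv_cancel_left]
  have hup : ∀ i j, i < j → (p i j : k) = lam * q j i := fun i j hij => by
    rw [hp.2 i j hij.ne, h j i hij, mul_inv, inv_inv, hq.2 j i hij.ne', Units.val_mul]
  have hqq : ∀ i j, (q i j * q j i : k) = 1 := fun i j => by
    rw [← Units.val_mul, hq.mul_eq_one, Units.val_one]
  lift (fun i j => gen lam q j i)
    (fun l m i j hl hm => by
      rw [gen_cross hm hl, gen_anti hm hl.le, smul_smul]
      congr 2
      · rw [hup j m hm]; linear_combination -(q m j : k) * hlow l i hl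
      · linear_combination -((lam : k) - 1) * q m j * (q l i * hlow l i hl + hqq i l))
    (fun l m i j hl hm => by
      rcases hm.lt_or_eq with hm | rfl
      · rw [gen_anti hm hl.le, smul_smul]
        nth_rw 1 [← one_smul k (gen lam q m l * gen lam q j i)]
        congr 1
        linear_combination -(lam * p j m * q j m * q l i : k) * hlow l i hl -
          (q i l * q l i * q j m : k) * hlow j m hm - (q m j * q j m : k) * hqq i l - hqq m j
      · rw [gen_row hl, hp.1, ← hlow l i hl, Units.val_one, mul_one])
    (fun i m j hm => by
      rw [gen_anti hm le_rfl, hup j m hm, hq.1, Units.val_one, mul_one])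

/-- The algebra map `X_{ij} ↦ X_{n+1-i, n+1-j}`. -/
def revHom (hq : IsMultiplicativelyAntisymmetric q)
    (hlm : lam * mu = 1) (h : ∀ i j, p i j = q i.rev j.rev) :
    QuantumMatrixAlgebra lam p →ₐ[k] QuantumMatrixAlgebra mu q :=
  have hqq : ∀ i j, (q i j * q j i : k) = 1 := fun i j => by
    rw [← Units.val_mul, hq.mul_eq_one, Units.val_one]
  have hlm' : (lam * mu : k) = 1 := by rw [← Units.val_mul, hlm, Units.val_one]
  lift (fun i j => gen mu q i.rev j.rev)
    (fun l m i j hl hm => by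
      rw [gen_cross (Fin.rev_lt_rev.2 hl) (Fin.rev_lt_rev.2 hm),
        gen_anti (Fin.rev_lt_rev.2 hl) (Fin.rev_lt_rev.2 hm).le, h, h]
      match_scalars
      · linear_combination -(q j.rev m.rev * q m.rev j.rev : k) * hqq l.rev i.rev -
          hqq j.rev m.rev
      · linear_combination -(mu - 1 + (lam - 1) * mu : k) * q j.rev m.rev * hqq l.rev i.rev -
          q j.rev m.rev * hlm')
    (fun l m i j hl hm => by
      rw [gen_anti (Fin.rev_lt_rev.2 hl) (Fin.rev_le_rev.2 hm), h, h]
      match_scalars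
      linear_combination -(q j.rev m.rev * q m.rev j.rev * lam * mu : k) * hqq l.rev i.rev -
          (lam * mu : k) * hqq j.rev m.rev - hlm')
    (fun i m j hm => by
      rw [gen_row (Fin.rev_lt_rev.2 hm), h]
      match_scalars
      linear_combination -hqq j.rev m.rev)

@[simp]
theorem transposeHom_gen (hp : IsMultiplicativelyAntisymmetric p)
    (hq : IsMultiplicativelyAntisymmetric q) (h : ∀ i j, j < i → p i j = lam⁻¹ * q j i)
    (i j : Fin n) : transposeHom hp hq h (gen lam p i j) = gen lam q j i :=
  lift_gen _ _ _ _ _ _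

@[simp]
theorem revHom_gen (hq : IsMultiplicativelyAntisymmetric q)
    (hlm : lam * mu = 1) (h : ∀ i j, p i j = q i.rev j.rev) (i j : Fin n) :
    revHom hq hlm h (gen lam p i j) = gen mu q i.rev j.rev :=
  lift_gen _ _ _ _ _ _

/-- Transposition as an isomorphism. -/
def transposeEquiv (hp : IsMultiplicativelyAntisymmetric p)
    (hq : IsMultiplicativelyAntisymmetric q) (h : ∀ i j, j < i → p i j = lam⁻¹ * q j i) :
    QuantumMatrixAlgebra lam p ≃ₐ[k] QuantumMatrixAlgebra lam q :=
  have h' : ∀ i j, j < i → q i j = lam⁻¹ * p j i := fun i j hij => by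
    rw [hp.2 j i hij.ne, h i j hij, mul_inv, inv_inv, inv_mul_cancel_left, hq.2 i j hij.ne']
  AlgEquiv.ofAlgHom (transposeHom hp hq h) (transposeHom hq hp h')
    (algHom_ext fun i j => by simp) (algHom_ext fun i j => by simp)

/-- The half turn as an isomorphism. -/
def revEquiv (hp : IsMultiplicativelyAntisymmetric p)
    (hq : IsMultiplicativelyAntisymmetric q) (hlm : lam * mu = 1)
    (h : ∀ i j, p i j = q i.rev j.rev) :
    QuantumMatrixAlgebra lam p ≃ₐ[k] QuantumMatrixAlgebra mu q :=
  AlgEquiv.ofAlgHom (revHom hq hlm h)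
    (revHom hp (by rw [mul_comm, hlm]) fun i j => by simp [h])
    (algHom_ext fun i j => by simp) (algHom_ext fun i j => by simp)

theorem nonempty_algEquiv (hp : IsMultiplicativelyAntisymmetric p)
    (hq : IsMultiplicativelyAntisymmetric q)
    (h : (lam = mu ∧ ∀ i j, p i j = q i j) ∨
      (lam = mu ∧ ∀ i j, j < i → p i j = lam⁻¹ * q j i) ∨
      (lam = mu⁻¹ ∧ ∀ i j, p i j = q i.rev j.rev) ∨
      (lam = mu⁻¹ ∧ ∀ i j, j < i → p i j = lam⁻¹ * q j.rev i.rev)) :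
    Nonempty (QuantumMatrixAlgebra lam p ≃ₐ[k] QuantumMatrixAlgebra mu q) := by
  rcases h with ⟨rfl, h⟩ | ⟨rfl, h⟩ | ⟨rfl, h⟩ | ⟨rfl, h⟩
  · obtain rfl : p = q := Matrix.ext h
    exact ⟨AlgEquiv.refl⟩
  · exact ⟨transposeEquiv hp hq h⟩
  · exact ⟨revEquiv hp hq (inv_mul_cancel mu) h⟩
  · have hq' : IsMultiplicativelyAntisymmetric
        (Matrix.of fun i j : Fin n => q i.rev j.rev) :=
      ⟨fun i => hq.1 _, fun i j hij => hq.2 _ _ (by simpa using hij)⟩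
    exact ⟨(transposeEquiv hp hq' h).trans
      (revEquiv hq' hq (inv_mul_cancel mu) fun i j => rfl)⟩

end Symmetries

/-! ### Truncation after degree two -/

section Truncation

variable {k : Type*} [Field k] {J ι : Type*}

/-- The algebra `k ⊕ kᴶ ⊕ k^ι` whose elements are a constant, a linear and a quadratic term. Two
linear terms multiply into the quadratic part, the `s`-th coordinate of their product being the value
of the form `_B s`; all products of degree at least three vanish. For a family `_B` spanning the
quadratic dual of a quadratic algebra, it contains the truncation of that algebra after degree two. -/
def QuadraticTruncation (_B : ι → Matrix J J k) : Type _ := k × (J → k) × (ι → k)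

namespace QuadraticTruncation

variable {B : ι → Matrix J J k}

instance : AddCommGroup (QuadraticTruncation B) :=
  inferInstanceAs (AddCommGroup (k × (J → k) × (ι → k)))

instance : Module k (QuadraticTruncation B) :=
  inferInstanceAs (Module k (k × (J → k) × (ι → k)))

/-- The constant term. -/
def const : QuadraticTruncation B →ₗ[k] k := LinearMap.fst k k ((J → k) × (ι → k))

/-- The linear term. -/
def lin : QuadraticTruncation B →ₗ[k] (J → k) :=
  LinearMap.fst k (J → k) (ι → k) ∘ₗ LinearMap.snd k k ((J → k) × (ι → k))

/-- The quadratic term. -/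
def quad : QuadraticTruncation B →ₗ[k] (ι → k) :=
  LinearMap.snd k (J → k) (ι → k) ∘ₗ LinearMap.snd k k ((J → k) × (ι → k))

/-- The element with the given constant, linear and quadratic terms. -/
def mk (e : k) (v : J → k) (g : ι → k) : QuadraticTruncation B := (e, v, g)

@[simp] theorem const_mk (e : k) (v : J → k) (g : ι → k) : const (mk (B := B) e v g) = e := rfl
@[simp] theorem lin_mk (e : k) (v : J → k) (g : ι → k) : lin (mk (B := B) e v g) = v := rfl
@[simp] theorem quad_mk (e : k) (v : J → k) (g : ι → k) : quad (mk (B := B) e v g) = g := rfl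

theorem ext {x y : QuadraticTruncation B} (h1 : const x = const y) (h2 : lin x = lin y)
    (h3 : quad x = quad y) : x = y :=
  Prod.ext h1 (Prod.ext h2 h3)

instance : One (QuadraticTruncation B) := ⟨mk 1 0 0⟩

@[simp] theorem const_one : const (1 : QuadraticTruncation B) = 1 := rfl
@[simp] theorem lin_one : lin (1 : QuadraticTruncation B) = 0 := rfl
@[simp] theorem quad_one : quad (1 : QuadraticTruncation B) = 0 := rfl
variable [Fintype J]

instance : Mul (QuadraticTruncation B) where
  mul x y := mk (const x * const y) (const x • lin y + const y • lin x)
    (fun s => const x * quad y s + const y * quad x s + lin x ⬝ᵥ (B s).mulVec (lin y))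

@[simp] theorem const_mul (x y : QuadraticTruncation B) :
    const (x * y) = const x * const y := rfl
@[simp] theorem lin_mul (x y : QuadraticTruncation B) :
    lin (x * y) = const x • lin y + const y • lin x := rfl
@[simp] theorem quad_mul (x y : QuadraticTruncation B) :
    quad (x * y) = fun s => const x * quad y s + const y * quad x s +
      lin x ⬝ᵥ (B s).mulVec (lin y) := rfl

instance : Ring (QuadraticTruncation B) where
  __ := (inferInstance : AddCommGroup (QuadraticTruncation B))
  left_distrib x y z := by
    refine ext ?_ ?_ (funext fun s => ?_) <;>
      simp [mul_add, add_smul, Matrix.mulVec_add, dotProduct_add, add_mul] <;> abel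
  right_distrib x y z := by
    refine ext ?_ ?_ (funext fun s => ?_) <;>
      simp [mul_add, add_smul, add_dotProduct, add_mul] <;> abel
  zero_mul x := by refine ext ?_ ?_ (funext fun s => ?_) <;> simp
  mul_zero x := by refine ext ?_ ?_ (funext fun s => ?_) <;> simp
  mul_assoc x y z := by
    refine ext ?_ ?_ (funext fun s => ?_)
    · simp [mul_assoc]
    · simp only [lin_mul, const_mul, smul_add, smul_smul, mul_comm, add_assoc]
    · simp only [lin_mul, const_mul, quad_mul, add_dotProduct, smul_dotProduct, dotProduct_add,
        Matrix.mulVec_add, Matrix.mulVec_smul, dotProduct_smul, smul_eq_mul]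
      ring
  one_mul x := by refine ext ?_ ?_ (funext fun s => ?_) <;> simp
  mul_one x := by refine ext ?_ ?_ (funext fun s => ?_) <;> simp

instance : Algebra k (QuadraticTruncation B) :=
  Algebra.ofModule
    (fun r x y => by
      refine ext ?_ ?_ (funext fun s => ?_)
      · simp [mul_assoc]
      · simp [smul_smul, mul_comm]
      · simp; ring)
    (fun r x y => by
      refine ext ?_ ?_ (funext fun s => ?_)
      · simp [mul_left_comm]
      · simp [smul_smul, mul_comm]
      · simp [Matrix.mulVec_smul]; ring)

@[simp] theorem lin_algebraMap (r : k) :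
    lin (algebraMap k (QuadraticTruncation B) r) = 0 := by
  simp [Algebra.algebraMap_eq_smul_one]

end QuadraticTruncation
end Truncation

/-! ### The linear part of an isomorphism -/

section Jacobian

variable {k : Type*} [Field k] {n m : ℕ} {lam mu : kˣ} {p : Matrix (Fin n) (Fin n) kˣ}
  {q : Matrix (Fin m) (Fin m) kˣ}

open QuadraticTruncation

/-- The map onto constant, linear and quadratic terms; the quadratic part is recorded by its values
under all forms in the quadratic dual. -/
def truncationHom (mu : kˣ) (q : Matrix (Fin m) (Fin m) kˣ) : QuantumMatrixAlgebra mu q →ₐ[k]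
    QuadraticTruncation (fun β : quadraticDual mu q => β.1) :=
  have hmul : ∀ i j l t, mk 0 (Pi.single (i, j) 1) 0 * mk 0 (Pi.single (l, t) 1) 0 =
      mk (B := fun β : quadraticDual mu q => β.1) 0 0 (fun β => β.1 (i, j) (l, t)) := by
    intro i j l t
    refine QuadraticTruncation.ext ?_ ?_ (funext fun s => ?_) <;> simp
  lift (fun i j => mk 0 (Pi.single (i, j) 1) 0)
    (fun l m i j hl hm => by
      rw [hmul, hmul, hmul]
      refine QuadraticTruncation.ext ?_ ?_ (funext fun s => ?_)
      · simp
      · simp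
      · simpa using s.2.1 l m i j hl hm)
    (fun l m i j hl hm => by
      rw [hmul, hmul]
      refine QuadraticTruncation.ext ?_ ?_ (funext fun s => ?_)
      · simp
      · simp
      · simpa using s.2.2.1 l m i j hl hm)
    (fun i m j hm => by
      rw [hmul, hmul]
      refine QuadraticTruncation.ext ?_ ?_ (funext fun s => ?_)
      · simp
      · simp
      · simpa using s.2.2.2 i m j hm)

theorem truncationHom_gen (i j : Fin m) :
    truncationHom mu q (gen mu q i j) = mk 0 (Pi.single (i, j) 1) 0 :=
  lift_gen _ _ _ _ _ _

/-- The matrix of linear terms of an algebra map: the column of `a` lists the coefficients of the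
linear term of `φ X_a`. -/
def jacobian (φ : QuantumMatrixAlgebra lam p →ₐ[k] QuantumMatrixAlgebra mu q) :
    Matrix (Fin m × Fin m) (Fin n × Fin n) k :=
  Matrix.of fun c a => lin (truncationHom mu q (φ (gen lam p a.1 a.2))) c

/-- The rows of the Jacobian are independent: a combination of linear-term functionals composed with
`φ` obeys the Leibniz rule, hence vanishes identically if it vanishes on generators, while `φ` is
surjective. -/
theorem eq_zero_of_vecMul_jacobian
    (φ : QuantumMatrixAlgebra lam p ≃ₐ[k] QuantumMatrixAlgebra mu q) {t : Fin m × Fin m → k}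
    (ht : Matrix.vecMul t (jacobian φ.toAlgHom) = 0) : t = 0 := by
  have key : ∀ x, t ⬝ᵥ lin (truncationHom mu q (φ x)) = 0 := by
    refine induction_gen (fun r => ?_) (fun i j => ?_) (fun x y hx hy => ?_) (fun x y hx hy => ?_)
    · simp
    · exact congrFun ht (i, j)
    · simp [hx, hy, dotProduct_add]
    · simp [hx, hy, dotProduct_add]
  ext ⟨i, j⟩
  simpa [truncationHom_gen] using key (φ.symm (gen mu q i j))

theorem le_of_algEquiv (φ : QuantumMatrixAlgebra lam p ≃ₐ[k] QuantumMatrixAlgebra mu q) :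
    m ≤ n := by
  have hinj : Function.Injective (jacobian φ.toAlgHom).vecMulLinear :=
    (injective_iff_map_eq_zero _).2 fun t ht => eq_zero_of_vecMul_jacobian φ ht
  have h := LinearMap.finrank_le_finrank_of_injective hinj
  simp only [Module.finrank_fintype_fun_eq_card, Fintype.card_prod, Fintype.card_fin] at h
  exact Nat.mul_self_le_mul_self_iff.1 h

end Jacobian

section Square

variable {k : Type*} [Field k] {n : ℕ} {lam mu : kˣ} {p q : Matrix (Fin n) (Fin n) kˣ}

open QuadraticTruncation

theorem isUnit_jacobian (φ : QuantumMatrixAlgebra lam p ≃ₐ[k] QuantumMatrixAlgebra mu q) :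
    IsUnit (jacobian φ.toAlgHom) :=
  Matrix.vecMul_injective_iff_isUnit.1
    ((injective_iff_map_eq_zero (jacobian φ.toAlgHom).vecMulLinear).2
      fun _ ht => eq_zero_of_vecMul_jacobian φ ht)

/-- The linear part of an algebra map respects the quadratic relations, provided that it is
invertible. The quadratic term of `φ X_a φ X_b` is `(Lᵀ β L) a b + α a * γ b + α b * γ a`, where `α`
and `γ` are the constant and quadratic terms. The forms `α a * L c b + α b * L c a`, coming from the
linear terms, lie in the quadratic dual, and `γ` is a combination of the rows of `L`. -/
theorem jacobian_map (φ : QuantumMatrixAlgebra lam p →ₐ[k] QuantumMatrixAlgebra mu q)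
    (hL : IsUnit (jacobian φ)) {β : Matrix (Fin n × Fin n) (Fin n × Fin n) k}
    (hβ : β ∈ quadraticDual mu q) :
    (jacobian φ).transpose * β * jacobian φ ∈ quadraticDual lam p := by
  set f := (truncationHom mu q).comp φ
  set L := jacobian φ with hLdef
  obtain ⟨M, -, hML⟩ := isUnit_iff_exists.1 hL
  have h1 := form_mem f (LinearMap.proj (⟨β, hβ⟩ : quadraticDual mu q) ∘ₗ quad)
  have h2 : ∀ c, _ := fun c => form_mem f (LinearMap.proj c ∘ₗ lin)
  set γ : Fin n × Fin n → k := fun a => quad (f (gen lam p a.1 a.2)) ⟨β, hβ⟩ with hγ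
  set α : Fin n × Fin n → k := fun a => const (f (gen lam p a.1 a.2)) with hα
  have hu : ∀ a, ∑ c, Matrix.vecMul γ M c * L c a = γ a := fun a => by
    have : Matrix.vecMul (Matrix.vecMul γ M) L a = γ a := by
      rw [Matrix.vecMul_vecMul, hML, Matrix.vecMul_one]
    exact this
  have h3 := Submodule.sub_mem _ h1
    (Submodule.sum_mem _ fun c (_ : c ∈ Finset.univ) =>
      Submodule.smul_mem _ (Matrix.vecMul γ M c) (h2 c))
  convert h3 using 1
  ext a b
  have hform : (L.transpose * β * L) a b =
      lin (f (gen lam p a.1 a.2)) ⬝ᵥ β.mulVec (lin (f (gen lam p b.1 b.2))) := by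
    rw [Matrix.mul_assoc, Matrix.mul_apply]
    rfl
  have hsum : (∑ c, Matrix.vecMul γ M c * (α a * L c b + α b * L c a)) =
      α a * γ b + α b * γ a := by
    rw [← hu b, ← hu a, Finset.mul_sum, Finset.mul_sum, ← Finset.sum_add_distrib]
    exact Finset.sum_congr rfl fun c _ => by ring
  rw [hform]
  simp only [Matrix.sub_apply, Matrix.sum_apply, Matrix.smul_apply, Matrix.of_apply,
    LinearMap.comp_apply, LinearMap.proj_apply, quad_mul, lin_mul, Pi.add_apply, Pi.smul_apply,
    smul_eq_mul]
  rw [eq_sub_iff_add_eq]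
  refine (congrArg _ hsum).trans ?_
  simp only [hγ, hα]
  ring

/-- The congruence action `β ↦ Lᵀ β L` as a linear map of quadratic duals. -/
def congruence (L : Matrix (Fin n × Fin n) (Fin n × Fin n) k)
    (h : ∀ β ∈ quadraticDual mu q, L.transpose * β * L ∈ quadraticDual lam p) :
    quadraticDual mu q →ₗ[k] quadraticDual lam p where
  toFun β := ⟨L.transpose * β.1 * L, h β.1 β.2⟩
  map_add' β γ := Subtype.ext (by simp [Matrix.mul_add, Matrix.add_mul])
  map_smul' c β := Subtype.ext (by simp)

theorem congruence_injective {L : Matrix (Fin n × Fin n) (Fin n × Fin n) k} (hL : IsUnit L)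
    (h : ∀ β ∈ quadraticDual mu q, L.transpose * β * L ∈ quadraticDual lam p) :
    Function.Injective (congruence L h) := by
  intro β γ hβγ
  have h1 : L.transpose * β.1 * L = L.transpose * γ.1 * L := congrArg Subtype.val hβγ
  have hT : IsUnit L.transpose := (Matrix.isUnit_transpose L).2 hL
  exact Subtype.ext (hT.mul_left_cancel (hL.mul_right_cancel h1))

/-- An algebra isomorphism yields an invertible matrix carrying one quadratic dual onto the other.
The Jacobian of `φ⁻¹` need not be the inverse of the Jacobian of `φ`, as the two are taken at different
characters; surjectivity instead follows by comparing dimensions. -/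
theorem exists_congruence (φ : QuantumMatrixAlgebra lam p ≃ₐ[k] QuantumMatrixAlgebra mu q) :
    ∃ L : Matrix (Fin n × Fin n) (Fin n × Fin n) k, IsUnit L ∧
      (∀ β ∈ quadraticDual mu q, L.transpose * β * L ∈ quadraticDual lam p) ∧
      ∀ γ ∈ quadraticDual lam p, ∃ β ∈ quadraticDual mu q, L.transpose * β * L = γ := by
  have h1 := isUnit_jacobian φ
  have h2 := isUnit_jacobian φ.symm
  have m1 := fun β (hβ : β ∈ quadraticDual mu q) => jacobian_map φ.toAlgHom h1 hβ
  have m2 := fun β (hβ : β ∈ quadraticDual lam p) => jacobian_map φ.symm.toAlgHom h2 hβ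
  have i1 := congruence_injective h1 m1
  have i2 := congruence_injective h2 m2
  have hrank := le_antisymm (LinearMap.finrank_le_finrank_of_injective i1)
    (LinearMap.finrank_le_finrank_of_injective i2)
  refine ⟨_, h1, m1, fun γ hγ => ?_⟩
  obtain ⟨β, hβ⟩ := (LinearMap.injective_iff_surjective_of_finrank_eq_finrank hrank).1 i1 ⟨γ, hγ⟩
  exact ⟨β.1, β.2, congrArg Subtype.val hβ⟩

end Square

end QuantumMatrixAlgebra

/-! ### The classification -/

open QuantumMatrixAlgebra in
theorem theorem4 {k : Type*} [Field k] {n m : ℕ} (hnm : 2 ≤ n ∨ 2 ≤ m) (lam mu : kˣ)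
    (hlam : lam ≠ 1) (hlam' : lam ≠ -1)
    (p : Matrix (Fin n) (Fin n) kˣ) (hp : IsMultiplicativelyAntisymmetric p)
    (q : Matrix (Fin m) (Fin m) kˣ) (hq : IsMultiplicativelyAntisymmetric q) :
    Nonempty (QuantumMatrixAlgebra lam p ≃ₐ[k] QuantumMatrixAlgebra mu q) ↔
      ∃ h : n = m,
        (lam = mu ∧ ∀ i j : Fin n, p i j = q (i.cast h) (j.cast h)) ∨
        (lam = mu ∧ ∀ i j : Fin n, j < i → p i j = lam⁻¹ * q (j.cast h) (i.cast h)) ∨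
        (lam = mu⁻¹ ∧ ∀ i j : Fin n, p i j = q (i.rev.cast h) (j.rev.cast h)) ∨
        (lam = mu⁻¹ ∧ ∀ i j : Fin n, j < i →
          p i j = lam⁻¹ * q (j.rev.cast h) (i.rev.cast h)) := by
  constructor
  · rintro ⟨φ⟩
    obtain rfl : n = m := le_antisymm (le_of_algEquiv φ.symm) (le_of_algEquiv φ)
    have hn : 2 ≤ n := hnm.elim id id
    refine ⟨rfl, ?_⟩
    obtain ⟨L, hL, hmap, hsurj⟩ := exists_congruence φ
    obtain ⟨w, c, hw, hc, hLw⟩ := exists_monomial hn hlam hp hL hmap hsurj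
    simp only [map_form_eq hLw] at hmap
    exact parameters_of_monomial hn hp hq hc hmap
      ((preservesRectangles_of_monomial hlam hq hw hc hmap).classification hw hn)
  · rintro ⟨rfl, h⟩
    exact nonempty_algEquiv hp hq h
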